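/- Let $\alpha\in[1,2)$ and $\mu>0$, and let $x_1,x_2\in\mathbb{R}^2$ satisfy $x_1\neq x_2$ and $|x_1|=|x_2|=1$ (Euclidean norm). Let $T_1<T_2$ be real numbers and let $x\in C^2([T_1,T_2];\mathbb{R}^2\setminus\{0\})$ be a parabolic (that is, zero-energy) solution of the fixed-endpoints problem $$\ddot x=-\frac{\mu x}{|x|^{\alpha+2}}\ \text{ on } [T_1,T_2],\qquad x(T_1)=x_1,\quad x(T_2)=x_2,$$ meaning that moreover $\tfrac12|\dot x(t)|^2=\dfrac{\mu}{\alpha|x(t)|^{\alpha}}$ for all $t\in[T_1,T_2]$. Then $$\int_{T_1}^{T_2}\left(\tfrac12|\dot x(t)|^2+\frac{\mu}{\alpha|x(t)|^{\alpha}}\right)dt<\sqrt{\frac{2\mu}{\alpha}}\;\frac{4}{2-\alpha}.$$ -/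

import Mathlib

noncomputable section

/-- The Euclidean plane `ℝ²`. -/
abbrev Plane : Type := EuclideanSpace ℝ (Fin 2)

namespace CentralProblem

/-- The velocity `ẋ(t)` of a path defined on the time interval `I` (one-sided at an endpoint
that belongs to `I`). -/
def velocity (I : Set ℝ) (x : ℝ → Plane) (t : ℝ) : Plane :=
  derivWithin x I t

/-- The acceleration `ẍ(t)` of a path defined on the time interval `I`. -/
def acceleration (I : Set ℝ) (x : ℝ → Plane) (t : ℝ) : Plane :=
  derivWithin (velocity I x) I t

/-- The potential `μ / (α |x|^α)` of the `α`-homogeneous central problem. -/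
def potential (α μ : ℝ) (x : Plane) : ℝ :=
  μ / (α * ‖x‖ ^ α)

/-- `x : I → ℝ² ∖ {0}` is a classical (collision-free, `C²`) solution of
`ẍ = - μ x / |x|^(α+2)` on the time interval `I`. -/
structure IsSolutionOn (α μ : ℝ) (I : Set ℝ) (x : ℝ → Plane) : Prop where
  contDiffOn : ContDiffOn ℝ 2 x I
  ne_zero : ∀ t ∈ I, x t ≠ 0
  equation : ∀ t ∈ I, acceleration I x t = -((μ / ‖x t‖ ^ (α + 2)) • x t)

/-- A parabolic solution is a solution with zero energy: `½ |ẋ|² = μ / (α |x|^α)`. -/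
structure IsParabolicSolutionOn (α μ : ℝ) (I : Set ℝ) (x : ℝ → Plane) : Prop
    extends IsSolutionOn α μ I x where
  zero_energy : ∀ t ∈ I, (1 / 2) * ‖velocity I x t‖ ^ 2 = potential α μ (x t)

/-- The action `∫_{T₁}^{T₂} (½ |ẋ|² + μ / (α |x|^α)) dt`.  For a solution on `[T₁, T₂]` the
integrand is continuous on `[T₁, T₂]`, so this is a genuine integral. -/
def action (α μ T₁ T₂ : ℝ) (x : ℝ → Plane) : ℝ :=
  ∫ t in T₁..T₂, ((1 / 2) * ‖velocity (Set.Icc T₁ T₂) x t‖ ^ 2 + potential α μ (x t))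

end CentralProblem

end

/-!
For a zero-energy path the Lagrangian is `L = κ |x|^(-α)` with `κ = 2μ/α`. Let `P = ⟪x, ẋ⟫`.
The equation of motion gives the Lagrange–Jacobi identity `P' = (2 - α)/2 · L`
(`hasDerivWithinAt_radialMomentum`), so the action is `2/(2 - α)` times the increment of `P`.
On the unit circle the speed is `√κ`, so the increment is at most `2√κ` by Cauchy–Schwarz, and this
is the claimed bound with `≤`.

Strictness comes from the first integral `κ |x|^(2-α) - P²`, the squared angular momentum
(`sq_angularMomentum_eq`). Equality in the bound forces `P = -√κ` at the initial time and
`P = √κ` at the final time, so the first integral vanishes identically while `P` vanishes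
somewhere in between; there `|x| = 0`, a collision, which is excluded.
-/

open Set

namespace CentralProblem

variable {α μ T₁ T₂ : ℝ} {x : ℝ → Plane}

/-- The quantity `⟪x, ẋ⟫`, half the time derivative of `|x|²`. -/
noncomputable def radialMomentum (I : Set ℝ) (x : ℝ → Plane) (t : ℝ) : ℝ :=
  inner ℝ (x t) (velocity I x t)

namespace IsSolutionOn

theorem hasDerivWithinAt (hx : IsSolutionOn α μ (Icc T₁ T₂) x)
    {t : ℝ} (ht : t ∈ Icc T₁ T₂) :
    HasDerivWithinAt x (velocity (Icc T₁ T₂) x t) (Icc T₁ T₂) t :=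
  (hx.contDiffOn.differentiableOn (by norm_num) t ht).hasDerivWithinAt

theorem hasDerivWithinAt_velocity (hT : T₁ < T₂) (hx : IsSolutionOn α μ (Icc T₁ T₂) x)
    {t : ℝ} (ht : t ∈ Icc T₁ T₂) :
    HasDerivWithinAt (velocity (Icc T₁ T₂) x) (-((μ / ‖x t‖ ^ (α + 2)) • x t))
      (Icc T₁ T₂) t := by
  have hv : ContDiffOn ℝ 1 (velocity (Icc T₁ T₂) x) (Icc T₁ T₂) :=
    hx.contDiffOn.derivWithin (uniqueDiffOn_Icc hT) (by norm_num)
  have h := (hv.differentiableOn (by norm_num) t ht).hasDerivWithinAt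
  rwa [show derivWithin (velocity (Icc T₁ T₂) x) (Icc T₁ T₂) t = _ from hx.equation t ht] at h

end IsSolutionOn

namespace IsParabolicSolutionOn

theorem norm_velocity_sq {I : Set ℝ} (hα : 0 < α) (hx : IsParabolicSolutionOn α μ I x)
    {t : ℝ} (ht : t ∈ I) : ‖velocity I x t‖ ^ 2 = 2 * μ / α * ‖x t‖ ^ (-α) := by
  have h := hx.zero_energy t ht
  have hr : 0 < ‖x t‖ ^ α := Real.rpow_pos_of_pos (norm_pos_iff.2 (hx.ne_zero t ht)) _
  rw [potential] at h
  rw [Real.rpow_neg (norm_nonneg _)]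
  field_simp at h ⊢
  linarith

theorem lagrangian_eq {I : Set ℝ} (hα : 0 < α) (hx : IsParabolicSolutionOn α μ I x)
    {t : ℝ} (ht : t ∈ I) :
    (1 / 2) * ‖velocity I x t‖ ^ 2 + potential α μ (x t) = 2 * μ / α * ‖x t‖ ^ (-α) := by
  rw [← hx.zero_energy t ht, ← hx.norm_velocity_sq hα ht]
  ring

/-- The Lagrange–Jacobi identity at zero energy. -/
theorem hasDerivWithinAt_radialMomentum (hα : 0 < α) (hT : T₁ < T₂)
    (hx : IsParabolicSolutionOn α μ (Icc T₁ T₂) x) {t : ℝ} (ht : t ∈ Icc T₁ T₂) :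
    HasDerivWithinAt (radialMomentum (Icc T₁ T₂) x)
      ((2 - α) / 2 * (2 * μ / α * ‖x t‖ ^ (-α))) (Icc T₁ T₂) t := by
  have hr : 0 < ‖x t‖ := norm_pos_iff.2 (hx.ne_zero t ht)
  have hpow : ‖x t‖ ^ (α + 2) = ‖x t‖ ^ α * ‖x t‖ ^ 2 := by
    rw [Real.rpow_add hr, Real.rpow_two]
  refine ((hx.hasDerivWithinAt ht).inner ℝ
    (hx.hasDerivWithinAt_velocity hT ht)).congr_deriv ?_
  have hr' : 0 < ‖x t‖ ^ α := Real.rpow_pos_of_pos hr _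
  rw [inner_neg_right, inner_smul_right, real_inner_self_eq_norm_sq,
    real_inner_self_eq_norm_sq, hx.norm_velocity_sq hα ht, hpow, Real.rpow_neg hr.le]
  field_simp
  ring

theorem continuousOn_radialMomentum (hα : 0 < α) (hT : T₁ < T₂)
    (hx : IsParabolicSolutionOn α μ (Icc T₁ T₂) x) :
    ContinuousOn (radialMomentum (Icc T₁ T₂) x) (Icc T₁ T₂) := fun _ ht =>
  (hx.hasDerivWithinAt_radialMomentum hα hT ht).continuousWithinAt

theorem hasDerivWithinAt_norm_rpow
    (hx : IsParabolicSolutionOn α μ (Icc T₁ T₂) x) {t : ℝ} (ht : t ∈ Icc T₁ T₂) :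
    HasDerivWithinAt (fun s => ‖x s‖ ^ (2 - α))
      ((2 - α) * ‖x t‖ ^ (-α) * radialMomentum (Icc T₁ T₂) x t) (Icc T₁ T₂) t := by
  have hr : 0 < ‖x t‖ := norm_pos_iff.2 (hx.ne_zero t ht)
  have hsq (s : ℝ) : (‖x s‖ ^ 2) ^ ((2 - α) / 2) = ‖x s‖ ^ (2 - α) := by
    rw [← Real.rpow_two, ← Real.rpow_mul (norm_nonneg _)]
    congr 1
    ring
  have hneg : (‖x t‖ ^ 2) ^ ((2 - α) / 2 - 1) = ‖x t‖ ^ (-α) := by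
    rw [← Real.rpow_two, ← Real.rpow_mul (norm_nonneg _)]
    congr 1
    ring
  have h := (hx.hasDerivWithinAt ht).norm_sq.rpow_const (p := (2 - α) / 2)
    (Or.inl (by positivity))
  simp only [hsq, hneg] at h
  refine h.congr_deriv ?_
  rw [radialMomentum]
  ring

/-- The first integral `κ |x|^(2-α) - ⟪x, ẋ⟫²`, where `κ = 2μ/α`; by the zero-energy relation
`κ |x|^(2-α) = |x|² |ẋ|²`, so it is the squared angular momentum. -/
theorem sq_angularMomentum_eq (hα : 0 < α) (hT : T₁ < T₂)
    (hx : IsParabolicSolutionOn α μ (Icc T₁ T₂) x) {t : ℝ} (ht : t ∈ Icc T₁ T₂) :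
    2 * μ / α * ‖x t‖ ^ (2 - α) - radialMomentum (Icc T₁ T₂) x t ^ 2 =
      2 * μ / α * ‖x T₁‖ ^ (2 - α) - radialMomentum (Icc T₁ T₂) x T₁ ^ 2 := by
  have hd : ∀ s ∈ Icc T₁ T₂, HasDerivWithinAt
      (fun s => 2 * μ / α * ‖x s‖ ^ (2 - α) - radialMomentum (Icc T₁ T₂) x s ^ 2) 0
      (Icc T₁ T₂) s := fun s hs => by
    refine (((hx.hasDerivWithinAt_norm_rpow hs).const_mul (2 * μ / α)).sub
      ((hx.hasDerivWithinAt_radialMomentum hα hT hs).pow 2)).congr_deriv ?_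
    push_cast
    ring
  exact constant_of_derivWithin_zero (fun s hs => (hd s hs).differentiableWithinAt)
    (fun s hs => (hd s (Ico_subset_Icc_self hs)).derivWithin
      (uniqueDiffOn_Icc hT s (Ico_subset_Icc_self hs))) t ht

theorem action_eq (hα : 0 < α) (hα₂ : α < 2) (hT : T₁ < T₂)
    (hx : IsParabolicSolutionOn α μ (Icc T₁ T₂) x) :
    action α μ T₁ T₂ x = 2 / (2 - α) *
      (radialMomentum (Icc T₁ T₂) x T₂ - radialMomentum (Icc T₁ T₂) x T₁) := by
  have hcont : ContinuousOn (fun t => (2 - α) / 2 * (2 * μ / α * ‖x t‖ ^ (-α)))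
      (Icc T₁ T₂) :=
    continuousOn_const.mul (continuousOn_const.mul (hx.contDiffOn.continuousOn.norm.rpow_const
      fun t ht => Or.inl (norm_ne_zero_iff.2 (hx.ne_zero t ht))))
  have hftc := intervalIntegral.integral_eq_sub_of_hasDerivAt_of_le hT.le
    (hx.continuousOn_radialMomentum hα hT)
    (fun t ht => (hx.hasDerivWithinAt_radialMomentum hα hT (Ioo_subset_Icc_self ht)).hasDerivAt
      (Icc_mem_nhds ht.1 ht.2))
    (hcont.intervalIntegrable_of_Icc hT.le)
  rw [intervalIntegral.integral_const_mul] at hftc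
  have hL : action α μ T₁ T₂ x = ∫ t in T₁..T₂, 2 * μ / α * ‖x t‖ ^ (-α) :=
    intervalIntegral.integral_congr fun t ht =>
      hx.lagrangian_eq hα (by rwa [uIcc_of_le hT.le] at ht)
  have : 2 - α ≠ 0 := by linarith
  rw [hL, ← hftc]
  field_simp

theorem abs_radialMomentum_le {I : Set ℝ} (hα : 0 < α)
    (hx : IsParabolicSolutionOn α μ I x) {t : ℝ} (ht : t ∈ I) (hnorm : ‖x t‖ = 1) :
    |radialMomentum I x t| ≤ √(2 * μ / α) := by
  have hv := hx.norm_velocity_sq hα ht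
  rw [hnorm, Real.one_rpow, mul_one] at hv
  rw [← hv, Real.sqrt_sq (norm_nonneg _)]
  simpa [radialMomentum, hnorm] using abs_real_inner_le_norm (x t) (velocity I x t)

end IsParabolicSolutionOn

end CentralProblem

open CentralProblem in
theorem proposition6p2 (α μ : ℝ) (hα₁ : 1 ≤ α) (hα₂ : α < 2) (hμ : 0 < μ)
    (x₁ x₂ : Plane) (hne : x₁ ≠ x₂) (hx₁ : ‖x₁‖ = 1) (hx₂ : ‖x₂‖ = 1)
    (T₁ T₂ : ℝ) (hT : T₁ < T₂) (x : ℝ → Plane)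
    (hx : CentralProblem.IsParabolicSolutionOn α μ (Set.Icc T₁ T₂) x)
    (hxT₁ : x T₁ = x₁) (hxT₂ : x T₂ = x₂) :
    CentralProblem.action α μ T₁ T₂ x < Real.sqrt (2 * μ / α) * (4 / (2 - α)) := by
  have hα : 0 < α := by linarith
  have hκ : 0 < 2 * μ / α := by positivity
  have hk : 0 < √(2 * μ / α) := Real.sqrt_pos.2 hκ
  have hP₁ := abs_le.1 (hx.abs_radialMomentum_le hα (left_mem_Icc.2 hT.le)
    (by rw [hxT₁, hx₁]))
  have hP₂ := abs_le.1 (hx.abs_radialMomentum_le hα (right_mem_Icc.2 hT.le)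
    (by rw [hxT₂, hx₂]))
  have hlt : radialMomentum (Icc T₁ T₂) x T₂ - radialMomentum (Icc T₁ T₂) x T₁ <
      2 * √(2 * μ / α) := by
    by_contra! hge
    have hP₁_eq : radialMomentum (Icc T₁ T₂) x T₁ = -√(2 * μ / α) := by linarith
    -- A zero of `P` would be a collision, because the first integral vanishes.
    obtain ⟨t, ht, hPt⟩ := intermediate_value_Icc hT.le (hx.continuousOn_radialMomentum hα hT)
      (show (0 : ℝ) ∈ Icc _ _ from ⟨by linarith, by linarith⟩)
    have hC := hx.sq_angularMomentum_eq hα hT ht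
    rw [hPt, hP₁_eq, hxT₁, hx₁, Real.one_rpow, neg_sq, Real.sq_sqrt hκ.le] at hC
    have hr : 0 < ‖x t‖ ^ (2 - α) :=
      Real.rpow_pos_of_pos (norm_pos_iff.2 (hx.ne_zero t ht)) _
    have := mul_pos hκ hr
    linarith
  have h2 : 0 < 2 - α := by linarith
  calc action α μ T₁ T₂ x
      = 2 / (2 - α) *
        (radialMomentum (Icc T₁ T₂) x T₂ - radialMomentum (Icc T₁ T₂) x T₁) :=
        hx.action_eq hα hα₂ hT
    _ < 2 / (2 - α) * (2 * √(2 * μ / α)) := by gcongr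
    _ = √(2 * μ / α) * (4 / (2 - α)) := by ring
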